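/- Let $0<c<1$ be fixed. For each $n$, let $s=s(n)$ be $cn$ rounded (up or down) to an integer, and let $Y=Y_n$ be the number of independent draws required to collect all of $n$ distinct coupons, when each draw is a package of $s$ distinct coupons, chosen uniformly at random among all $\binom{n}{s}$ subsets of size $s$. Let $\alpha(n)=\{\log_{1/(1-c)} n\}$ be the fractional part of $\log_{1/(1-c)} n$, and for $x\in[0,1)$ let $$g(x)=\sum_{i=1}^{\infty}\left(1-e^{-(1-c)^{i-x-1}}-e^{-(1-c)^{-i-x}}\right),$$ a convergent series. Then $\mathbb{E}[Y_n]$ is finite for all sufficiently large $n$ and, as $n\to\infty$, $$\mathbb{E}[Y_n]=\lfloor\log_{1/(1-c)} n\rfloor+g(\alpha(n))+o(1).$$ -/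

import Mathlib

open MeasureTheory ProbabilityTheory Filter Topology

noncomputable section

/-- `A t ω` is the package obtained in draw number `t + 1`. The draws are independent, and each one
is uniformly distributed over the subsets of size `s` of a set of `n` coupons. -/
structure IsUniformPackageDraws {n : ℕ} (s : ℕ) {Ω : Type*} [MeasurableSpace Ω] (μ : Measure Ω)
    (A : ℕ → Ω → Finset (Fin n)) : Prop where
  measurable : ∀ t, Measurable[_, ⊤] (A t)
  indep : iIndepFun (m := fun _ => ⊤) A μ
  uniform : ∀ t (B : Finset (Fin n)),
    μ {ω | A t ω = B} = if B.card = s then ((n.choose s : ℕ) : ENNReal)⁻¹ else 0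

/-- The number of draws required to collect all coupons: the least `m` such that every coupon
belongs to one of the first `m` packages (`⊤` if there is no such `m`). -/
def collectionTime {n : ℕ} {Ω : Type*} (A : ℕ → Ω → Finset (Fin n)) (ω : Ω) : ℕ∞ :=
  ⨅ (m : ℕ) (_ : ∀ j : Fin n, ∃ t < m, j ∈ A t ω), (m : ℕ∞)

/-- The expectation of the number of draws, as an element of `[0, ∞]`. -/
def expectedCollectionTime {n : ℕ} {Ω : Type*} [MeasurableSpace Ω] (μ : Measure Ω)
    (A : ℕ → Ω → Finset (Fin n)) : ENNReal :=
  ∫⁻ ω, (collectionTime A ω : ENNReal) ∂μ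

/-- The summand with index `i ≥ 1` of the series that defines `g`. -/
def gTerm (c x : ℝ) (i : ℕ) : ℝ :=
  1 - Real.exp (-(1 - c) ^ ((i : ℝ) - x - 1)) - Real.exp (-(1 - c) ^ (-(i : ℝ) - x))

/-- `g(x)`, the sum over all `i ≥ 1` (hence the shift by one). -/
def g (c x : ℝ) : ℝ := ∑' i : ℕ, gTerm c x (i + 1)

end

/-! With `F m` the probability that `m` draws cover everything, `E[Y] = ∑ (1 - F m)`. Put `k = ⌊log
n⌋` (base `1/(1-c)`) and regroup around `k`: `E[Y] = k + ∑ᵢ ((1 - F (k+i)) - F (k-1-i))`. After `k +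
p` draws the number of missing coupons is nearly Poisson with mean `n(1-c)^(k+p) = (1-c)^(p-α)`, so
`F (k+p) ≈ exp(-(1-c)^(p-α))`, and the regrouped series tends termwise to the one defining `g(α)`.
This is inclusion-exclusion plus dominated convergence (`tendsto_sum_choose_sub_exp`). As `α`
oscillates with `n`, limits are stated for differences or quotients. The outer sum is again passed
to the limit by domination (`tendsto_tsum_one_sub_coverProb`): the union bound makes `1 - F (k+i)`
geometrically small, the second moment makes `F (k-1-i)` so. -/

/-- The set of coupons that belong to none of the first `m` packages. -/
def missed {n : ℕ} {Ω : Type*} (A : ℕ → Ω → Finset (Fin n)) (m : ℕ) (ω : Ω) : Finset (Fin n) :=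
  {j | ∀ t < m, j ∉ A t ω}

/-- The probability that a uniformly distributed package of size `s` out of `n` coupons avoids
`r` given coupons. -/
noncomputable def avoidProb (n s r : ℕ) : ℝ := ((n - r).choose s : ℝ) / (n.choose s : ℝ)

lemma avoidProb_nonneg (n s r : ℕ) : 0 ≤ avoidProb n s r := by unfold avoidProb; positivity

lemma subset_missed_iff {n : ℕ} {Ω : Type*} (A : ℕ → Ω → Finset (Fin n)) (m : ℕ) (ω : Ω)
    (S : Finset (Fin n)) : S ⊆ missed A m ω ↔ ∀ t < m, Disjoint S (A t ω) := by
  simp only [missed, Finset.subset_iff, Finset.mem_filter, Finset.mem_univ, true_and,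
    Finset.disjoint_left]
  exact ⟨fun h t ht j hj => h hj t ht, fun h j hj t ht => h t ht hj⟩

/-! ### Moments of the number of missing coupons -/

namespace IsUniformPackageDraws

variable {n s : ℕ} {Ω : Type*} [MeasurableSpace Ω] {μ : Measure Ω}
  {A : ℕ → Ω → Finset (Fin n)}

lemma measurableSet_disjoint (hA : IsUniformPackageDraws s μ A) (S : Finset (Fin n)) (t : ℕ) :
    MeasurableSet {ω | Disjoint S (A t ω)} :=
  @hA.measurable t {B | Disjoint S B} trivial

lemma measurableSet_subset_missed (hA : IsUniformPackageDraws s μ A) (S : Finset (Fin n)) (m : ℕ) :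
    MeasurableSet {ω | S ⊆ missed A m ω} := by
  simp only [subset_missed_iff, Set.ofPred_forall]
  exact MeasurableSet.iInter fun t => MeasurableSet.iInter fun _ => hA.measurableSet_disjoint S t

lemma measurableSet_missed_eq_empty (hA : IsUniformPackageDraws s μ A) (m : ℕ) :
    MeasurableSet {ω | missed A m ω = ∅} := by
  have : {ω | missed A m ω = ∅} = ⋂ j : Fin n, {ω | {j} ⊆ missed A m ω}ᶜ := by
    ext ω
    simp [Finset.eq_empty_iff_forall_notMem]
  rw [this]
  exact MeasurableSet.iInter fun j => (hA.measurableSet_subset_missed _ m).compl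

variable [IsProbabilityMeasure μ]

lemma measureReal_disjoint (hA : IsUniformPackageDraws s μ A) (S : Finset (Fin n)) (t : ℕ) :
    μ.real {ω | Disjoint S (A t ω)} = avoidProb n s S.card := by
  classical
  have h1 : {ω | Disjoint S (A t ω)} =
      ⋃ B ∈ (Finset.univ.filter fun B : Finset (Fin n) => Disjoint S B), {ω | A t ω = B} := by
    ext ω; simp
  have h2 : ∀ B : Finset (Fin n), μ.real {ω | A t ω = B} =
      if B.card = s then ((n.choose s : ℕ) : ℝ)⁻¹ else 0 := by
    intro B
    rw [measureReal_def, hA.uniform]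
    split_ifs <;> simp
  rw [h1, measureReal_biUnion_finset]
  · simp only [h2]
    rw [← Finset.sum_filter, Finset.sum_const, nsmul_eq_mul, avoidProb, div_eq_mul_inv]
    congr 2
    have : (Finset.univ.filter fun B : Finset (Fin n) => Disjoint S B).filter (fun B => B.card = s)
        = Finset.powersetCard s Sᶜ := by
      ext B
      simp only [Finset.mem_filter, Finset.mem_univ, true_and, Finset.mem_powersetCard]
      rw [Finset.subset_compl_iff_disjoint_left]
    rw [this, Finset.card_powersetCard, Finset.card_compl, Fintype.card_fin]
  · intro B _ C _ hBC
    exact Set.disjoint_left.2 fun ω hB hC => hBC (hB.symm.trans hC)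
  · exact fun B _ => @hA.measurable t {B} trivial

lemma measureReal_subset_missed (hA : IsUniformPackageDraws s μ A) (S : Finset (Fin n)) (m : ℕ) :
    μ.real {ω | S ⊆ missed A m ω} = avoidProb n s S.card ^ m := by
  have h1 : {ω | S ⊆ missed A m ω} =
      ⋂ t ∈ Finset.range m, A t ⁻¹' {B | Disjoint S B} := by
    ext ω; simp [subset_missed_iff]
  rw [h1, measureReal_def, hA.indep.measure_inter_preimage_eq_mul _ (fun _ _ => trivial),
    ENNReal.toReal_prod, ← Finset.card_range m, ← Finset.prod_const, Finset.card_range]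
  exact Finset.prod_congr rfl fun t _ => hA.measureReal_disjoint S t

/-- Common source of inclusion-exclusion (`S` over all subsets), the union bound (singletons) and
the second moment (pairs). -/
lemma integral_sum_indicator_subset_missed (hA : IsUniformPackageDraws s μ A) {ι : Type*}
    (I : Finset ι) (a : ι → ℝ) (S : ι → Finset (Fin n)) (m : ℕ) :
    Integrable (fun ω => ∑ i ∈ I, a i * if S i ⊆ missed A m ω then (1 : ℝ) else 0) μ ∧
    ∫ ω, (∑ i ∈ I, a i * if S i ⊆ missed A m ω then (1 : ℝ) else 0) ∂μ =
      ∑ i ∈ I, a i * avoidProb n s (S i).card ^ m := by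
  have hind : ∀ i, (fun ω => if S i ⊆ missed A m ω then (1 : ℝ) else 0) =
      {ω | S i ⊆ missed A m ω}.indicator 1 := by
    intro i; ext ω; simp [Set.indicator_apply]
  have hint : ∀ i, Integrable (fun ω => if S i ⊆ missed A m ω then (1 : ℝ) else 0) μ := by
    intro i
    rw [hind]
    exact (integrable_const (1 : ℝ)).indicator (hA.measurableSet_subset_missed _ m)
  refine ⟨integrable_finsetSum _ fun i _ => (hint i).const_mul _, ?_⟩
  rw [integral_finsetSum _ fun i _ => (hint i).const_mul _]
  refine Finset.sum_congr rfl fun i _ => ?_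
  rw [integral_const_mul, hind, integral_indicator_one (hA.measurableSet_subset_missed _ m),
    hA.measureReal_subset_missed]

lemma integral_missed_eq_empty (hA : IsUniformPackageDraws s μ A) (m : ℕ) :
    Integrable (fun ω => if missed A m ω = ∅ then (1 : ℝ) else 0) μ ∧
    ∫ ω, (if missed A m ω = ∅ then (1 : ℝ) else 0) ∂μ = μ.real {ω | missed A m ω = ∅} := by
  have : (fun ω => if missed A m ω = ∅ then (1 : ℝ) else 0) =
      {ω | missed A m ω = ∅}.indicator 1 := by
    ext ω; simp [Set.indicator_apply]
  rw [this, integral_indicator_one (hA.measurableSet_missed_eq_empty m)]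
  exact ⟨(integrable_const (1 : ℝ)).indicator (hA.measurableSet_missed_eq_empty m), rfl⟩

/-- Inclusion-exclusion for the probability that the first `m` packages cover all coupons. -/
lemma measureReal_missed_eq_empty (hA : IsUniformPackageDraws s μ A) (m : ℕ) :
    μ.real {ω | missed A m ω = ∅} =
      ∑ r ∈ Finset.range (n + 1), (n.choose r : ℝ) * ((-1) ^ r * avoidProb n s r ^ m) := by
  rw [← (hA.integral_missed_eq_empty m).2]
  -- The alternating sum over the subsets of a finite set vanishes unless the set is empty.
  have h : ∀ ω, (if missed A m ω = ∅ then (1 : ℝ) else 0) =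
      ∑ S ∈ (Finset.univ : Finset (Fin n)).powerset,
        (-1 : ℝ) ^ S.card * if S ⊆ missed A m ω then (1 : ℝ) else 0 := by
    intro ω
    have h0 := congrArg (Int.cast : ℤ → ℝ)
      (Finset.sum_powerset_neg_one_pow_card (x := missed A m ω))
    push_cast at h0
    rw [← h0]
    simp only [mul_ite, mul_one, mul_zero]
    rw [← Finset.sum_filter]
    refine Finset.sum_congr ?_ fun _ _ => rfl
    ext S; simp
  simp only [h]
  rw [(hA.integral_sum_indicator_subset_missed _ (fun S => (-1 : ℝ) ^ S.card) (fun S => S) m).2]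
  rw [Finset.sum_powerset_apply_card (fun r => (-1 : ℝ) ^ r * avoidProb n s r ^ m)]
  simp

/-- Union bound. -/
lemma one_sub_measureReal_missed_eq_empty_le (hA : IsUniformPackageDraws s μ A) (m : ℕ) :
    1 - μ.real {ω | missed A m ω = ∅} ≤ n * avoidProb n s 1 ^ m := by
  have h1 := hA.integral_missed_eq_empty m
  have h2 := hA.integral_sum_indicator_subset_missed (Finset.univ : Finset (Fin n))
    (fun _ => (1 : ℝ)) (fun j => {j}) m
  have h3 : (n : ℝ) * avoidProb n s 1 ^ m = ∑ i : Fin n, (1 : ℝ) *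
      avoidProb n s ({i} : Finset (Fin n)).card ^ m := by simp
  have h4 : (1 : ℝ) - ∫ ω, (if missed A m ω = ∅ then (1 : ℝ) else 0) ∂μ =
      ∫ ω, (1 - if missed A m ω = ∅ then (1 : ℝ) else 0) ∂μ := by
    rw [integral_sub (integrable_const _) h1.1]; simp
  rw [h3, ← h2.2, ← h1.2, h4]
  refine integral_mono ((integrable_const _).sub h1.1) h2.1 fun ω => ?_
  simp only [one_mul, Finset.singleton_subset_iff, Finset.sum_ite_mem, Finset.univ_inter,
    Finset.sum_const, nsmul_eq_mul, mul_one]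
  split_ifs with h
  · simp
  · simpa using Finset.one_le_card.2 (Finset.nonempty_iff_ne_empty.2 h)

/-- The second moment bound. -/
lemma sq_mul_measureReal_missed_eq_empty_le (hA : IsUniformPackageDraws s μ A) (m : ℕ)
    (h21 : avoidProb n s 2 ≤ avoidProb n s 1 ^ 2) :
    (n * avoidProb n s 1 ^ m) ^ 2 * μ.real {ω | missed A m ω = ∅} ≤ n * avoidProb n s 1 ^ m := by
  set l : ℝ := n * avoidProb n s 1 ^ m with hl
  have h1 := hA.integral_missed_eq_empty m
  have h2 := hA.integral_sum_indicator_subset_missed (Finset.univ : Finset (Fin n))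
    (fun _ => (1 : ℝ)) (fun j => {j}) m
  have h3 := hA.integral_sum_indicator_subset_missed (Finset.univ : Finset (Fin n × Fin n))
    (fun _ => (1 : ℝ)) (fun p => {p.1, p.2}) m
  have e2 : ∀ ω, (∑ j : Fin n, (1 : ℝ) * if {j} ⊆ missed A m ω then (1 : ℝ) else 0) =
      (missed A m ω).card := by
    intro ω; simp
  have e3 : ∀ ω, (∑ p : Fin n × Fin n, (1 : ℝ) *
      if {p.1, p.2} ⊆ missed A m ω then (1 : ℝ) else 0) = ((missed A m ω).card : ℝ) ^ 2 := by
    intro ω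
    have : (Finset.univ.filter fun p : Fin n × Fin n => {p.1, p.2} ⊆ missed A m ω) =
        missed A m ω ×ˢ missed A m ω := by
      ext p; simp [Finset.insert_subset_iff]
    simp only [one_mul]
    rw [Finset.sum_boole, this, Finset.card_product]
    push_cast; ring
  simp only [e2] at h2
  simp only [e3] at h3
  have v2 : ∫ ω, ((missed A m ω).card : ℝ) ∂μ = l := by
    rw [h2.2]; simp [hl]
  have v3 : ∫ ω, ((missed A m ω).card : ℝ) ^ 2 ∂μ ≤ l + l ^ 2 := by
    rw [h3.2]
    -- Diagonal pairs give the first moment; off the diagonal, `h21` is negative correlation.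
    have hb : ∀ p : Fin n × Fin n, (1 : ℝ) * avoidProb n s ({p.1, p.2} : Finset (Fin n)).card ^ m
        ≤ (if p.1 = p.2 then avoidProb n s 1 ^ m else 0) + (avoidProb n s 1 ^ m) ^ 2 := by
      rintro ⟨i, j⟩
      rcases eq_or_ne i j with rfl | hij
      · simp; positivity
      · simp only [Finset.card_pair hij, hij, if_false, zero_add, one_mul]
        rw [← pow_mul, mul_comm m, pow_mul]
        exact pow_le_pow_left₀ (avoidProb_nonneg _ _ _) h21 m
    refine (Finset.sum_le_sum fun p _ => hb p).trans (le_of_eq ?_)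
    rw [Finset.sum_add_distrib, Fintype.sum_prod_type]
    simp [hl]; ring
  -- Chebyshev: `(N - l)²` equals `l²` where `N = 0`, and its mean is at most `l`.
  have hm : ∫ ω, l ^ 2 * (if missed A m ω = ∅ then (1 : ℝ) else 0) ∂μ ≤
      ∫ ω, (((missed A m ω).card : ℝ) ^ 2 - 2 * l * ((missed A m ω).card : ℝ) + l ^ 2) ∂μ := by
    refine integral_mono (h1.1.const_mul _)
      ((h3.1.sub (h2.1.const_mul _)).add (integrable_const _)) fun ω => ?_
    simp only
    split_ifs with h
    · simp [h]
    · nlinarith [sq_nonneg (((missed A m ω).card : ℝ) - l)]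
  rw [integral_const_mul, h1.2,
    integral_add (f := fun ω => ((missed A m ω).card : ℝ) ^ 2 - 2 * l * (missed A m ω).card)
      (h3.1.sub (h2.1.const_mul _)) (integrable_const _),
    integral_sub h3.1 (h2.1.const_mul _), integral_const_mul, v2] at hm
  simp only [integral_const, probReal_univ, smul_eq_mul, one_mul] at hm
  nlinarith

end IsUniformPackageDraws

/-! ### Expectation as a sum of tail probabilities -/

lemma lt_collectionTime_iff {n : ℕ} {Ω : Type*} (A : ℕ → Ω → Finset (Fin n)) (ω : Ω) (m : ℕ) :
    (m : ℕ∞) < collectionTime A ω ↔ missed A m ω ≠ ∅ := by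
  have key : collectionTime A ω ≤ m ↔ missed A m ω = ∅ := by
    have h0 : missed A m ω = ∅ ↔ ∀ j : Fin n, ∃ t < m, j ∈ A t ω := by
      simp [missed, Finset.filter_eq_empty_iff]
    rw [h0]
    constructor
    · intro h
      -- A strict bound on the infimum yields a witness, hence `m + 1`.
      have h' : collectionTime A ω < ((m + 1 : ℕ) : ℕ∞) :=
        h.trans_lt (by exact_mod_cast Nat.lt_succ_self m)
      simp only [collectionTime, iInf_lt_iff] at h'
      obtain ⟨k, hk, hkm⟩ := h'
      intro j
      obtain ⟨t, ht, hj⟩ := hk j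
      have : k < m + 1 := by exact_mod_cast hkm
      exact ⟨t, by omega, hj⟩
    · intro h
      exact iInf₂_le m h
  rw [← not_le, key]

lemma ENat.toENNReal_eq_tsum (x : ℕ∞) :
    (x : ENNReal) = ∑' m : ℕ, if (m : ℕ∞) < x then 1 else 0 := by
  induction x with
  | top => simp [ENNReal.tsum_one]
  | coe k =>
    rw [tsum_eq_sum (s := Finset.range k)]
    · simp only [Nat.cast_lt]
      rw [Finset.sum_congr rfl fun i hi => if_pos (Finset.mem_range.1 hi)]
      simp
    · intro b hb
      simpa using hb

lemma IsUniformPackageDraws.expectedCollectionTime_eq_tsum {n s : ℕ} {Ω : Type*}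
    [MeasurableSpace Ω] {μ : Measure Ω} [IsProbabilityMeasure μ] {A : ℕ → Ω → Finset (Fin n)}
    (hA : IsUniformPackageDraws s μ A) :
    expectedCollectionTime μ A =
      ∑' m : ℕ, ENNReal.ofReal (1 - μ.real {ω | missed A m ω = ∅}) := by
  have hm := hA.measurableSet_missed_eq_empty
  have h : ∀ ω, (collectionTime A ω : ENNReal) =
      ∑' m : ℕ, {ω | missed A m ω = ∅}ᶜ.indicator (1 : Ω → ENNReal) ω := by
    intro ω
    rw [ENat.toENNReal_eq_tsum]
    refine tsum_congr fun m => ?_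
    simp [lt_collectionTime_iff, Set.indicator_apply]
  simp only [expectedCollectionTime, h]
  rw [lintegral_tsum fun m => (measurable_one.indicator (hm m).compl).aemeasurable]
  refine tsum_congr fun m => ?_
  rw [lintegral_indicator_one (hm m).compl, ← probReal_compl_eq_one_sub (hm m)]
  simp

/-! ### Avoidance probabilities -/

lemma avoidProb_zero {n s : ℕ} (h : s ≤ n) : avoidProb n s 0 = 1 := by
  have : (n.choose s : ℝ) ≠ 0 := by exact_mod_cast (Nat.choose_pos h).ne'
  simp [avoidProb, this]

lemma avoidProb_succ {n r : ℕ} (s : ℕ) (h : r < n) :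
    avoidProb n s (r + 1) = avoidProb n s r * (((n - s - r : ℕ) : ℝ) / ((n : ℝ) - r)) := by
  have h1 := Nat.choose_mul_succ_eq (n - (r + 1)) s
  have h2 : n - (r + 1) + 1 = n - r := by omega
  rw [h2] at h1
  have h3 := congrArg (Nat.cast : ℕ → ℝ) h1
  rw [show n - r - s = n - s - r by omega] at h3
  push_cast [Nat.cast_sub h.le] at h3
  have h4 : (n : ℝ) - r ≠ 0 := by
    have : (r : ℝ) < n := by exact_mod_cast h
    linarith
  unfold avoidProb
  rw [div_mul_div_comm, ← h3, mul_div_mul_right _ _ h4]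

lemma avoidProb_one {n s : ℕ} (hn : 0 < n) (h : s ≤ n) :
    avoidProb n s 1 = ((n - s : ℕ) : ℝ) / n := by
  rw [avoidProb_succ s hn, avoidProb_zero h]; simp

/-- The factors `(n-s-r)/(n-r)` of the product decrease in `r`. Serves both the second moment (`r =
2`) and the domination of the binomial moments. -/
lemma avoidProb_le_pow {n s : ℕ} (h : s ≤ n) {r : ℕ} (hr : r ≤ n) :
    avoidProb n s r ≤ avoidProb n s 1 ^ r := by
  induction r with
  | zero => simp [avoidProb_zero h]
  | succ r ih =>
    have hrn : (r : ℝ) < n := by exact_mod_cast hr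
    have hn : (0 : ℝ) < n := lt_of_le_of_lt (Nat.cast_nonneg r) hrn
    rw [avoidProb_succ s (by omega), pow_succ]
    refine mul_le_mul (ih (by omega)) ?_ ?_ (pow_nonneg (avoidProb_nonneg _ _ _) _)
    · rw [avoidProb_one (by omega) h, div_le_div_iff₀ (by linarith) hn]
      rcases le_total r (n - s) with hc | hc
      · rw [Nat.cast_sub hc, Nat.cast_sub h]
        have : (0 : ℝ) ≤ s * r := by positivity
        nlinarith
      · rw [Nat.sub_eq_zero_of_le hc]
        have : (0 : ℝ) ≤ (n : ℝ) - r := by linarith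
        simp only [Nat.cast_zero, zero_mul]
        positivity
    · exact div_nonneg (Nat.cast_nonneg _) (by linarith)

/-- If `x n = 1 + O(1 / n)` and `m n = o(n)`, then `x n ^ m n → 1`. -/
lemma tendsto_pow_one_of_abs_sub_one_le {x : ℕ → ℝ} {m : ℕ → ℕ} {C : ℝ}
    (hx : ∀ᶠ n : ℕ in atTop, |x n - 1| ≤ C / n)
    (hm : Tendsto (fun n => (m n : ℝ) / n) atTop (𝓝 0)) :
    Tendsto (fun n => x n ^ m n) atTop (𝓝 1) := by
  have h0 : Tendsto (fun n => (m n : ℝ) * (x n - 1)) atTop (𝓝 0) := by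
    refine squeeze_zero_norm' (a := fun n => C * ((m n : ℝ) / n)) ?_ (by simpa using hm.const_mul C)
    filter_upwards [hx] with n hn
    rw [Real.norm_eq_abs, abs_mul, Nat.abs_cast]
    calc (m n : ℝ) * |x n - 1| ≤ m n * (C / n) := by gcongr
      _ = _ := by ring
  have hC : Tendsto (fun n : ℕ => C / (n : ℝ)) atTop (𝓝 0) := tendsto_const_div_atTop_nhds_zero_nat C
  have hsmall : ∀ᶠ n in atTop, |x n - 1| ≤ 1 := by
    filter_upwards [hx, hC.eventually (eventually_le_nhds one_pos)] with n h1 h2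
    exact h1.trans h2
  -- Squeeze `x ^ m` between `1 + m(x-1)` (Bernoulli) and `exp(m(x-1))`.
  refine tendsto_of_tendsto_of_tendsto_of_le_of_le' (by simpa using h0.const_add 1)
    (by simpa using (Real.continuous_exp.tendsto 0).comp h0) ?_ ?_
  · filter_upwards [hsmall] with n hn
    have := one_add_mul_le_pow (a := x n - 1) (by linarith [abs_le.1 hn]) (m n)
    simpa using this
  · filter_upwards [hsmall] with n hn
    have h1 := Real.add_one_le_exp (x n - 1)
    simp only [Function.comp, Real.exp_nat_mul]
    exact pow_le_pow_left₀ (by linarith [abs_le.1 hn]) (by linarith) _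

/-! ### Poisson approximation -/

section Asymptotics

variable {c : ℝ} {s : ℕ → ℕ}

lemma size_le (hc1 : c < 1) (hs : ∀ n, |(s n : ℝ) - c * n| < 1) (n : ℕ) : s n ≤ n := by
  have h1 := (abs_lt.1 (hs n)).2
  have : (s n : ℝ) < n + 1 := by nlinarith [Nat.cast_nonneg (α := ℝ) n]
  exact Nat.lt_succ_iff.1 (by exact_mod_cast this)

lemma eventually_abs_ratio_sub_one_le (hc0 : 0 < c) (hc1 : c < 1)
    (hs : ∀ n, |(s n : ℝ) - c * n| < 1) (t : ℕ) :
    ∀ᶠ n : ℕ in atTop, |((n - s n - t : ℕ) : ℝ) / ((n : ℝ) - t) / (1 - c) - 1| ≤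
      2 * (1 + t) / (1 - c) / n := by
  have ha : 0 < 1 - c := by linarith
  filter_upwards [eventually_ge_atTop (2 * t + 1),
    tendsto_natCast_atTop_atTop.eventually_ge_atTop ((t + 1) / (1 - c))] with n hn1 hn2
  have hn1' : (2 * t + 1 : ℝ) ≤ n := by exact_mod_cast hn1
  have ht : (0 : ℝ) ≤ t := Nat.cast_nonneg t
  have hsn := abs_lt.1 (hs n)
  rw [div_le_iff₀ ha] at hn2
  have h1 : t + s n ≤ n := by
    have : (t + s n : ℝ) ≤ n := by nlinarith
    exact_mod_cast this
  have h2 : ((n - s n - t : ℕ) : ℝ) = n - s n - t := by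
    rw [Nat.cast_sub (by omega), Nat.cast_sub (by omega)]
  have h3 : (0 : ℝ) < n - t := by linarith
  have h4 : ((n - s n - t : ℕ) : ℝ) / ((n : ℝ) - t) / (1 - c) - 1 =
      (c * n - s n - c * t) / ((n - t) * (1 - c)) := by
    rw [h2]; field_simp; ring
  rw [h4, abs_div, abs_of_pos (mul_pos h3 ha), div_div, div_le_div_iff₀ (by positivity) (by
    have : (0 : ℝ) < n := by linarith
    positivity)]
  have h5 : |c * n - s n - c * t| ≤ 1 + t := by
    rw [abs_le]; constructor <;> nlinarith
  calc |c * n - s n - c * t| * ((1 - c) * n) ≤ (1 + t) * ((1 - c) * n) := by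
        gcongr
    -- The factor 2 comes from `n ≤ 2(n - t)`.
    _ ≤ 2 * (1 + t) * ((n - t) * (1 - c)) := by
        have : (1 + t : ℝ) * (1 - c) * n ≤ (1 + t) * (1 - c) * (2 * (n - t)) := by
          gcongr; linarith
        linarith

variable {m : ℕ → ℕ}

lemma tendsto_ratio_pow (hc0 : 0 < c) (hc1 : c < 1)
    (hs : ∀ n, |(s n : ℝ) - c * n| < 1) (hm : Tendsto (fun n => (m n : ℝ) / n) atTop (𝓝 0))
    (t : ℕ) :
    Tendsto (fun n : ℕ => (((n - s n - t : ℕ) : ℝ) / ((n : ℝ) - t) / (1 - c)) ^ m n)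
      atTop (𝓝 1) :=
  tendsto_pow_one_of_abs_sub_one_le (eventually_abs_ratio_sub_one_le hc0 hc1 hs t) hm

lemma tendsto_avoidProb_one_pow_div (hc0 : 0 < c) (hc1 : c < 1)
    (hs : ∀ n, |(s n : ℝ) - c * n| < 1) (hm : Tendsto (fun n => (m n : ℝ) / n) atTop (𝓝 0)) :
    Tendsto (fun n : ℕ => (n * avoidProb n (s n) 1 ^ m n) / (n * (1 - c) ^ m n))
      atTop (𝓝 1) := by
  refine (tendsto_ratio_pow hc0 hc1 hs hm 0).congr' ?_
  filter_upwards [eventually_gt_atTop 0] with n hn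
  have : (n : ℝ) ≠ 0 := by exact_mod_cast hn.ne'
  rw [avoidProb_one hn (size_le hc1 hs n), mul_div_mul_left _ _ this, ← div_pow]
  simp

/-- The binomial moments are asymptotic to those of a Poisson variable. -/
lemma tendsto_choose_mul_avoidProb_div (hc0 : 0 < c) (hc1 : c < 1)
    (hs : ∀ n, |(s n : ℝ) - c * n| < 1) (hm : Tendsto (fun n => (m n : ℝ) / n) atTop (𝓝 0))
    (r : ℕ) :
    Tendsto (fun n : ℕ => ((n.choose r : ℝ) * avoidProb n (s n) r ^ m n) /
      ((n * (1 - c) ^ m n) ^ r / r.factorial)) atTop (𝓝 1) := by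
  have ha : 0 < 1 - c := by linarith
  induction r with
  | zero =>
    refine tendsto_const_nhds.congr fun n => ?_
    simp [avoidProb_zero (size_le hc1 hs n)]
  | succ r ih =>
    have h1 : Tendsto (fun n : ℕ => ((n : ℝ) - r) / n) atTop (𝓝 1) := by
      have := (tendsto_const_div_atTop_nhds_zero_nat (r : ℝ)).const_sub 1
      rw [sub_zero] at this
      refine this.congr' ?_
      filter_upwards [eventually_gt_atTop 0] with n hn
      have : (n : ℝ) ≠ 0 := by exact_mod_cast hn.ne'
      field_simp
    -- Passing from `r` to `r + 1` multiplies the quotient by exactly these two factors.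
    have h2 := (ih.mul h1).mul (tendsto_ratio_pow hc0 hc1 hs hm r)
    simp only [mul_one] at h2
    refine h2.congr' ?_
    filter_upwards [eventually_gt_atTop r] with n hn
    have hn0 : (n : ℝ) ≠ 0 := by
      have : 0 < n := by omega
      exact_mod_cast this.ne'
    have h3 := congrArg (Nat.cast : ℕ → ℝ) (Nat.choose_succ_right_eq n r)
    push_cast [Nat.cast_sub hn.le] at h3
    have h4 : (n.choose (r + 1) : ℝ) = n.choose r * (n - r) / (r + 1) := by
      rw [← h3]; field_simp
    rw [avoidProb_succ _ hn, h4, Nat.factorial_succ, div_pow _ (1 - c)]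
    simp only [mul_pow, pow_succ _ r]
    push_cast
    have : (1 - c) ^ m n ≠ 0 := by positivity
    field_simp

/-- The number of coupons missing after `m n` draws is asymptotically Poisson, at zero. -/
lemma tendsto_sum_choose_sub_exp (hc0 : 0 < c) (hc1 : c < 1)
    (hs : ∀ n, |(s n : ℝ) - c * n| < 1) (hm : Tendsto (fun n => (m n : ℝ) / n) atTop (𝓝 0))
    {L : ℝ} (hL : ∀ᶠ n : ℕ in atTop, n * (1 - c) ^ m n ≤ L) :
    Tendsto (fun n : ℕ => (∑ r ∈ Finset.range (n + 1),
        (n.choose r : ℝ) * ((-1) ^ r * avoidProb n (s n) r ^ m n)) -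
      Real.exp (-(n * (1 - c) ^ m n))) atTop (𝓝 0) := by
  have ha : 0 < 1 - c := by linarith
  set T : ℕ → ℕ → ℝ := fun n r => (n.choose r : ℝ) * avoidProb n (s n) r ^ m n with hT
  set l : ℕ → ℝ := fun n => n * (1 - c) ^ m n with hl
  have hl0 : ∀ n, 0 ≤ l n := fun n => by positivity
  have hT0 : ∀ n r, 0 ≤ T n r := fun n r =>
    mul_nonneg (Nat.cast_nonneg _) (pow_nonneg (avoidProb_nonneg _ _ _) _)
  have hsumT : ∀ n, HasSum (fun r => (-1) ^ r * T n r) (∑ r ∈ Finset.range (n + 1),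
        (n.choose r : ℝ) * ((-1) ^ r * avoidProb n (s n) r ^ m n)) := by
    intro n
    have h : HasSum (fun r => (-1) ^ r * T n r)
        (∑ r ∈ Finset.range (n + 1), (-1) ^ r * T n r) :=
      hasSum_sum_of_ne_finset_zero fun r hr => by
        simp only [Finset.mem_range, not_lt] at hr
        simp [hT, Nat.choose_eq_zero_of_lt (show n < r by omega)]
    convert h using 1
    exact Finset.sum_congr rfl fun r _ => by simp only [hT]; ring
  have hsumE : ∀ n, HasSum (fun r => (-1) ^ r * (l n ^ r / r.factorial)) (Real.exp (-l n)) := by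
    intro n
    rw [Real.exp_eq_exp_ℝ]
    have h := NormedSpace.expSeries_div_hasSum_exp (-l n)
    simp only [neg_pow (l n), mul_div_assoc] at h
    exact h
  have hdiff : ∀ n, (∑ r ∈ Finset.range (n + 1),
        (n.choose r : ℝ) * ((-1) ^ r * avoidProb n (s n) r ^ m n)) - Real.exp (-l n) =
      ∑' r, ((-1) ^ r * T n r - (-1) ^ r * (l n ^ r / r.factorial)) := fun n =>
    ((hsumT n).sub (hsumE n)).tsum_eq.symm
  -- Domination uniform in `r`: the exact mean is eventually at most `2 * l n`, hence at most `2 *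
  -- L`.
  have hbT : ∀ᶠ n : ℕ in atTop, ∀ r, T n r ≤ (2 * L) ^ r / r.factorial := by
    filter_upwards [hL, eventually_gt_atTop 0, (tendsto_avoidProb_one_pow_div hc0 hc1 hs
      hm).eventually (eventually_le_nhds one_lt_two)] with n h1 h2 h3 r
    have hlp : 0 < l n := by
      have : (0 : ℝ) < n := by exact_mod_cast h2
      positivity
    rw [div_le_iff₀ hlp] at h3
    have hL0 : 0 ≤ L := hlp.le.trans h1
    rcases le_or_gt r n with hr | hr
    · calc T n r ≤ (n : ℝ) ^ r / r.factorial * (avoidProb n (s n) 1 ^ r) ^ m n := by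
            refine mul_le_mul (Nat.choose_le_pow_div r n) (pow_le_pow_left₀
              (avoidProb_nonneg _ _ _) (avoidProb_le_pow (size_le hc1 hs n) hr) _)
              (pow_nonneg (avoidProb_nonneg _ _ _) _) (by positivity)
        _ = (n * avoidProb n (s n) 1 ^ m n) ^ r / r.factorial := by
            rw [mul_pow, ← pow_mul, ← pow_mul, mul_comm r]; ring
        _ ≤ _ := by
            have := avoidProb_nonneg n (s n) 1
            refine div_le_div_of_nonneg_right (pow_le_pow_left₀ (by positivity) ?_ r)
              (by positivity)
            linarith [show l n ≤ L from h1, show n * avoidProb n (s n) 1 ^ m n ≤ 2 * l n from h3]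
    · simp only [hT, Nat.choose_eq_zero_of_lt hr, Nat.cast_zero, zero_mul]
      positivity
  refine Tendsto.congr (fun n => (hdiff n).symm) ?_
  suffices h : Tendsto (fun n => ∑' r, ((-1) ^ r * T n r - (-1) ^ r * (l n ^ r / r.factorial)))
      atTop (𝓝 (∑' _ : ℕ, (0 : ℝ))) by rwa [tsum_zero] at h
  refine tendsto_tsum_of_dominated_convergence
    (bound := fun r => (2 * L) ^ r / r.factorial + L ^ r / r.factorial)
    ((Real.summable_pow_div_factorial _).add (Real.summable_pow_div_factorial _)) ?_ ?_
  · intro r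
    -- The relative error tends to 0; the bound `L` turns it into an absolute one.
    have h1 := (tendsto_choose_mul_avoidProb_div hc0 hc1 hs hm r).sub_const 1
    rw [sub_self] at h1
    have h2 := (h1.norm.mul_const (L ^ r / r.factorial))
    rw [norm_zero, zero_mul] at h2
    refine squeeze_zero_norm' ?_ h2
    filter_upwards [hL, eventually_gt_atTop 0] with n hn hn0
    have hlp : 0 < l n := by
      have : (0 : ℝ) < n := by exact_mod_cast hn0
      positivity
    have hE : 0 < l n ^ r / r.factorial := by positivity
    rw [← mul_sub, norm_mul, norm_pow, norm_neg, norm_one, one_pow, one_mul]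
    calc ‖T n r - l n ^ r / r.factorial‖
        = ‖T n r / (l n ^ r / r.factorial) - 1‖ * (l n ^ r / r.factorial) := by
          rw [← Real.norm_of_nonneg hE.le, ← norm_mul, Real.norm_of_nonneg hE.le, sub_mul,
            div_mul_cancel₀ _ hE.ne', one_mul]
      _ ≤ _ := by gcongr
  · filter_upwards [hbT, hL] with n h1 h2 r
    have hle : l n ^ r / r.factorial ≤ L ^ r / r.factorial := by
      have := hl0 n
      gcongr
    have h3 : 0 ≤ l n ^ r / r.factorial := by
      have := hl0 n
      positivity
    rw [← mul_sub, norm_mul, norm_pow, norm_neg, norm_one, one_pow, one_mul, Real.norm_eq_abs,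
      abs_le]
    constructor <;> linarith [h1 r, hT0 n r]

end Asymptotics

/-! ### Geometric bounds for the series `g` -/

section GSeries

variable {c x : ℝ}

lemma gTerm_succ (c x : ℝ) (i : ℕ) : gTerm c x (i + 1) =
    (1 - Real.exp (-(1 - c) ^ ((i : ℝ) - x))) - Real.exp (-(1 - c) ^ (-((i : ℝ) + 1) - x)) := by
  unfold gTerm
  push_cast
  rw [show (i : ℝ) + 1 - x - 1 = i - x by ring]

lemma one_sub_exp_neg_rpow_mem (hc0 : 0 < c) (hc1 : c < 1) (hx : x ∈ Set.Ico (0 : ℝ) 1) (i : ℕ) :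
    1 - Real.exp (-(1 - c) ^ ((i : ℝ) - x)) ∈ Set.Icc 0 (1 / (1 - c) * (1 - c) ^ i) := by
  have ha : 0 < 1 - c := by linarith
  have hp : 0 < (1 - c) ^ ((i : ℝ) - x) := Real.rpow_pos_of_pos ha _
  constructor
  · have : Real.exp (-(1 - c) ^ ((i : ℝ) - x)) ≤ 1 := Real.exp_le_one_iff.2 (by linarith)
    linarith
  · have h1 := Real.add_one_le_exp (-(1 - c) ^ ((i : ℝ) - x))
    have h2 : (1 - c) ^ ((i : ℝ) - x) ≤ (1 - c) ^ ((i : ℝ) - 1) :=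
      Real.rpow_le_rpow_of_exponent_ge ha (by linarith) (by linarith [hx.2])
    rw [Real.rpow_sub_one ha.ne', Real.rpow_natCast] at h2
    rw [one_div_mul_eq_div]
    linarith

/-- Since `exp(-u) ≤ 1/u`, with `u ≥ (1-c)^(-i)` here. -/
lemma exp_neg_rpow_mem (hc0 : 0 < c) (hc1 : c < 1) (hx : x ∈ Set.Ico (0 : ℝ) 1) (i : ℕ) :
    Real.exp (-(1 - c) ^ (-((i : ℝ) + 1) - x)) ∈ Set.Icc 0 ((1 - c) ^ i) := by
  have ha : 0 < 1 - c := by linarith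
  have hp : 0 < (1 - c) ^ (-((i : ℝ) + 1) - x) := Real.rpow_pos_of_pos ha _
  refine ⟨(Real.exp_pos _).le, ?_⟩
  have h1 := Real.add_one_le_exp ((1 - c) ^ (-((i : ℝ) + 1) - x))
  have h2 : (1 - c) ^ (-(i : ℝ)) ≤ (1 - c) ^ (-((i : ℝ) + 1) - x) :=
    Real.rpow_le_rpow_of_exponent_ge ha (by linarith) (by linarith [hx.1])
  rw [Real.rpow_neg ha.le, Real.rpow_natCast] at h2
  rw [Real.exp_neg]
  refine inv_le_of_inv_le₀ (by positivity) ?_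
  linarith

lemma abs_gTerm_succ_le (hc0 : 0 < c) (hc1 : c < 1) (hx : x ∈ Set.Ico (0 : ℝ) 1) (i : ℕ) :
    |gTerm c x (i + 1)| ≤ (1 / (1 - c) + 1) * (1 - c) ^ i := by
  have h1 := one_sub_exp_neg_rpow_mem hc0 hc1 hx i
  have h2 := exp_neg_rpow_mem hc0 hc1 hx i
  have ha : 0 < 1 - c := by linarith
  have h3 : 0 ≤ 1 / (1 - c) * (1 - c) ^ i := by positivity
  have h4 : 0 ≤ (1 - c) ^ i := by positivity
  rw [gTerm_succ, abs_le, add_mul, one_mul]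
  constructor <;> linarith [h1.1, h1.2, h2.1, h2.2]

lemma summable_gTerm_succ (hc0 : 0 < c) (hc1 : c < 1) (hx : x ∈ Set.Ico (0 : ℝ) 1) :
    Summable fun i : ℕ => gTerm c x (i + 1) :=
  Summable.of_norm_bounded
    ((summable_geometric_of_lt_one (by linarith) (by linarith)).mul_left _)
    (abs_gTerm_succ_le hc0 hc1 hx)

end GSeries

/-! ### The integer and fractional parts of the logarithm -/

section LogFloor

variable {c : ℝ}

lemma one_lt_one_div_one_sub (hc0 : 0 < c) (hc1 : c < 1) : 1 < 1 / (1 - c) := by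
  rw [lt_div_iff₀ (by linarith)]; linarith

lemma logb_natCast_nonneg (hc0 : 0 < c) (hc1 : c < 1) (n : ℕ) :
    0 ≤ Real.logb (1 / (1 - c)) n := by
  rcases n.eq_zero_or_pos with rfl | hn
  · simp
  · exact Real.logb_nonneg (one_lt_one_div_one_sub hc0 hc1) (by exact_mod_cast hn)

lemma natCast_floor_logb (hc0 : 0 < c) (hc1 : c < 1) (n : ℕ) :
    (⌊Real.logb (1 / (1 - c)) n⌋₊ : ℝ) = (⌊Real.logb (1 / (1 - c)) n⌋ : ℝ) :=
  natCast_floor_eq_intCast_floor (logb_natCast_nonneg hc0 hc1 n)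

/-- Writing `n` as a power of `1 - c` leaves minus the fractional part in the exponent; this is how
`α(n)` enters. -/
lemma natCast_mul_rpow_floor_logb_add (hc0 : 0 < c) (hc1 : c < 1) {n : ℕ} (hn : 0 < n) (p : ℝ) :
    n * (1 - c) ^ ((⌊Real.logb (1 / (1 - c)) n⌋₊ : ℝ) + p) =
      (1 - c) ^ (p - Int.fract (Real.logb (1 / (1 - c)) n)) := by
  have ha : 0 < 1 - c := by linarith
  have hb := one_lt_one_div_one_sub hc0 hc1
  have h1 : (n : ℝ) = (1 - c) ^ (-Real.logb (1 / (1 - c)) n) := by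
    rw [Real.rpow_neg ha.le, ← Real.inv_rpow ha.le, ← one_div,
      Real.rpow_logb (by linarith) hb.ne' (by exact_mod_cast hn)]
  rw [natCast_floor_logb hc0 hc1]
  conv_lhs => enter [1]; rw [h1]
  rw [← Real.rpow_add ha]
  congr 1
  rw [Int.fract]; ring

lemma tendsto_floor_logb_div (hc0 : 0 < c) (hc1 : c < 1) :
    Tendsto (fun n : ℕ => (⌊Real.logb (1 / (1 - c)) n⌋₊ : ℝ) / n) atTop (𝓝 0) := by
  have h1 : Tendsto (fun n : ℕ => Real.log n / n) atTop (𝓝 0) :=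
    Real.isLittleO_log_id_atTop.tendsto_div_nhds_zero.comp tendsto_natCast_atTop_atTop
  have h2 := h1.div_const (Real.log (1 / (1 - c)))
  rw [zero_div] at h2
  refine squeeze_zero (fun n => by positivity) (fun n => ?_) h2
  rw [div_right_comm]
  gcongr
  exact Nat.floor_le (logb_natCast_nonneg hc0 hc1 n)

lemma tendsto_floor_logb_atTop (hc0 : 0 < c) (hc1 : c < 1) :
    Tendsto (fun n : ℕ => ⌊Real.logb (1 / (1 - c)) n⌋₊) atTop atTop :=
  tendsto_nat_floor_atTop.comp
    ((Real.tendsto_logb_atTop (one_lt_one_div_one_sub hc0 hc1)).comp tendsto_natCast_atTop_atTop)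

end LogFloor

/-! ### Regrouping and the limit of the expectation -/

/-- Regrouping of `∑ (1 - F m)` around the index `k`. -/
lemma tsum_one_sub_eq_add_tsum {F : ℕ → ℝ} (hF : Summable fun m => 1 - F m) (k : ℕ) :
    Summable (fun i => (1 - F (k + i)) - if i < k then F (k - 1 - i) else 0) ∧
    ∑' m, (1 - F m) = k + ∑' i, ((1 - F (k + i)) - if i < k then F (k - 1 - i) else 0) := by
  have h1 : Summable fun i => 1 - F (k + i) := by
    simpa only [add_comm] using (summable_nat_add_iff k).2 hF
  -- Read backwards, so that `i` measures the distance below `k`; the guard excludes the truncated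
  -- values of `k - 1 - i`.
  have h2 : HasSum (fun i => if i < k then F (k - 1 - i) else 0)
      (∑ i ∈ Finset.range k, F i) := by
    have h : HasSum (fun i => if i < k then F (k - 1 - i) else 0)
        (∑ i ∈ Finset.range k, if i < k then F (k - 1 - i) else 0) :=
      hasSum_sum_of_ne_finset_zero fun i hi => if_neg (by simpa using hi)
    rw [Finset.sum_congr rfl fun i hi => if_pos (Finset.mem_range.1 hi),
      Finset.sum_range_reflect F k] at h
    exact h
  refine ⟨h1.sub h2.summable, ?_⟩
  rw [h1.tsum_sub h2.summable, h2.tsum_eq, ← hF.sum_add_tsum_nat_add k]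
  simp only [Finset.sum_sub_distrib, Finset.sum_const, Finset.card_range, nsmul_eq_mul, mul_one,
    add_comm k]
  ring

section Asymptotics

variable {c : ℝ} {s : ℕ → ℕ} {F : ℕ → ℕ → ℝ}

/-- A real offset `p` serves both sides of `k`: `p = i` and `p = -(i + 1)`. -/
lemma tendsto_coverProb_sub_exp (hc0 : 0 < c) (hc1 : c < 1)
    (hs : ∀ n, |(s n : ℝ) - c * n| < 1)
    (hF : ∀ n m, F n m = ∑ r ∈ Finset.range (n + 1),
      (n.choose r : ℝ) * ((-1) ^ r * avoidProb n (s n) r ^ m))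
    {m : ℕ → ℕ} {p : ℝ}
    (hm : ∀ᶠ n : ℕ in atTop, (m n : ℝ) = ⌊Real.logb (1 / (1 - c)) n⌋₊ + p) :
    Tendsto (fun n : ℕ => F n (m n) -
      Real.exp (-(1 - c) ^ (p - Int.fract (Real.logb (1 / (1 - c)) n)))) atTop (𝓝 0) := by
  have ha : 0 < 1 - c := by linarith
  have hl : ∀ᶠ n : ℕ in atTop, n * (1 - c) ^ m n =
      (1 - c) ^ (p - Int.fract (Real.logb (1 / (1 - c)) n)) := by
    filter_upwards [hm, eventually_gt_atTop 0] with n h1 h2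
    rw [← Real.rpow_natCast, h1, natCast_mul_rpow_floor_logb_add hc0 hc1 h2]
  have h0 : Tendsto (fun n => (m n : ℝ) / n) atTop (𝓝 0) := by
    have := (tendsto_floor_logb_div hc0 hc1).add (tendsto_const_div_atTop_nhds_zero_nat p)
    rw [add_zero] at this
    refine this.congr' ?_
    filter_upwards [hm] with n h1
    rw [h1, add_div]
  have hL : ∀ᶠ n : ℕ in atTop, n * (1 - c) ^ m n ≤ (1 - c) ^ (p - 1) := by
    filter_upwards [hl] with n h1
    rw [h1]
    exact Real.rpow_le_rpow_of_exponent_ge ha (by linarith)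
      (by linarith [Int.fract_lt_one (Real.logb (1 / (1 - c)) n)])
  refine (tendsto_sum_choose_sub_exp hc0 hc1 hs h0 hL).congr' ?_
  filter_upwards [hl] with n h1
  rw [hF, h1]

lemma tendsto_avoidProb_one (hc0 : 0 < c) (hc1 : c < 1) (hs : ∀ n, |(s n : ℝ) - c * n| < 1) :
    Tendsto (fun n : ℕ => avoidProb n (s n) 1) atTop (𝓝 (1 - c)) := by
  have ha : 0 < 1 - c := by linarith
  have h := (tendsto_ratio_pow (m := fun _ => 1) hc0 hc1 hs
    (tendsto_const_div_atTop_nhds_zero_nat _) 0).mul_const (1 - c)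
  rw [one_mul] at h
  refine h.congr' ?_
  filter_upwards [eventually_gt_atTop 0] with n hn
  rw [avoidProb_one hn (size_le hc1 hs n)]
  simp [ha.ne']

/-- The expected number of missing coupons after `⌊log n⌋` draws is bounded away from `0`
and `∞`. -/
lemma eventually_mul_avoidProb_one_pow_mem (hc0 : 0 < c) (hc1 : c < 1)
    (hs : ∀ n, |(s n : ℝ) - c * n| < 1) :
    ∀ᶠ n : ℕ in atTop, n * avoidProb n (s n) 1 ^ ⌊Real.logb (1 / (1 - c)) n⌋₊ ∈
      Set.Icc (1 / 2 : ℝ) (2 / (1 - c)) := by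
  have ha : 0 < 1 - c := by linarith
  have h := tendsto_avoidProb_one_pow_div hc0 hc1 hs (tendsto_floor_logb_div hc0 hc1)
  -- The limiting mean `(1-c)^(-α)` lies in `[1, 1/(1-c)]`; a factor 2 each way absorbs the error.
  filter_upwards [h.eventually (eventually_le_nhds one_lt_two),
    h.eventually (eventually_ge_nhds one_half_lt_one), eventually_gt_atTop 0] with n h1 h2 hn
  have hl := natCast_mul_rpow_floor_logb_add hc0 hc1 hn 0
  rw [add_zero, Real.rpow_natCast, zero_sub] at hl
  rw [hl] at h1 h2
  set y := Int.fract (Real.logb (1 / (1 - c)) n)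
  have hp : 0 < (1 - c) ^ (-y) := Real.rpow_pos_of_pos ha _
  rw [div_le_iff₀ hp] at h1
  rw [le_div_iff₀ hp] at h2
  have h3 : (1 - c) ^ (-y) ≤ (1 - c) ^ (-1 : ℝ) :=
    Real.rpow_le_rpow_of_exponent_ge ha (by linarith)
      (by linarith [Int.fract_lt_one (Real.logb (1 / (1 - c)) n)])
  have h4 : (1 : ℝ) ≤ (1 - c) ^ (-y) :=
    Real.one_le_rpow_of_pos_of_le_one_of_nonpos ha (by linarith)
      (by linarith [Int.fract_nonneg (Real.logb (1 / (1 - c)) n)])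
  rw [Real.rpow_neg_one] at h3
  exact ⟨by linarith, by rw [div_eq_mul_inv (2 : ℝ)]; linarith⟩

lemma tendsto_tsum_one_sub_coverProb (hc0 : 0 < c) (hc1 : c < 1)
    (hs : ∀ n, |(s n : ℝ) - c * n| < 1)
    (hF : ∀ n m, F n m = ∑ r ∈ Finset.range (n + 1),
      (n.choose r : ℝ) * ((-1) ^ r * avoidProb n (s n) r ^ m))
    (hF0 : ∀ n m, 0 ≤ F n m) (hF1 : ∀ n m, F n m ≤ 1)
    (hU : ∀ n m, 1 - F n m ≤ n * avoidProb n (s n) 1 ^ m)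
    (hV : ∀ n m, 2 ≤ n →
      (n * avoidProb n (s n) 1 ^ m) ^ 2 * F n m ≤ n * avoidProb n (s n) 1 ^ m) :
    (∀ᶠ n in atTop, Summable fun m => 1 - F n m) ∧
    Tendsto (fun n : ℕ => ∑' m, (1 - F n m) - ((⌊Real.logb (1 / (1 - c)) n⌋ : ℝ) +
      g c (Int.fract (Real.logb (1 / (1 - c)) n)))) atTop (𝓝 0) := by
  have ha : 0 < 1 - c := by linarith
  set k : ℕ → ℕ := fun n => ⌊Real.logb (1 / (1 - c)) n⌋₊ with hk
  set y : ℕ → ℝ := fun n => Int.fract (Real.logb (1 / (1 - c)) n) with hy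
  have hy01 : ∀ n, y n ∈ Set.Ico (0 : ℝ) 1 := fun n =>
    ⟨Int.fract_nonneg _, Int.fract_lt_one _⟩
  -- Any ratio strictly between `1 - c` and `1` would do: it eventually dominates `avoidProb n (s n)
  -- 1`.
  set ρ : ℝ := 1 - c / 2 with hρ
  have hρ0 : 0 < ρ := by linarith
  have hρ1 : ρ < 1 := by linarith
  have hgeo : Summable fun i : ℕ => ρ ^ i := summable_geometric_of_lt_one hρ0.le hρ1
  have hq : ∀ᶠ n : ℕ in atTop, avoidProb n (s n) 1 ∈ Set.Ioc 0 ρ := by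
    have h := tendsto_avoidProb_one hc0 hc1 hs
    filter_upwards [h.eventually (eventually_gt_nhds ha),
      h.eventually (eventually_le_nhds (show 1 - c < ρ by linarith))] with n h1 h2
    exact ⟨h1, h2⟩
  -- Only for large `n`: for small `n`, rounding down may give `s n = 0`.
  have hsum : ∀ᶠ n in atTop, Summable fun m => 1 - F n m := by
    filter_upwards [hq] with n h1
    refine Summable.of_nonneg_of_le (fun m => sub_nonneg.2 (hF1 n m)) (fun m => ?_)
      (hgeo.mul_left (n : ℝ))
    refine (hU n m).trans ?_
    have := h1.1.le
    have := h1.2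
    gcongr
  refine ⟨hsum, ?_⟩
  set f : ℕ → ℕ → ℝ := fun n i => ((1 - F n (k n + i)) -
    if i < k n then F n (k n - 1 - i) else 0) - gTerm c (y n) (i + 1) with hf
  have hEq : ∀ᶠ n : ℕ in atTop, ∑' i, f n i =
      ∑' m, (1 - F n m) - ((⌊Real.logb (1 / (1 - c)) n⌋ : ℝ) + g c (y n)) := by
    filter_upwards [hsum] with n hn
    obtain ⟨h1, h2⟩ := tsum_one_sub_eq_add_tsum hn (k n)
    rw [h2, h1.tsum_sub (summable_gTerm_succ hc0 hc1 (hy01 n)), ← natCast_floor_logb hc0 hc1, g]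
    ring
  refine Tendsto.congr' hEq ?_
  suffices h : Tendsto (fun n => ∑' i, f n i) atTop (𝓝 (∑' _ : ℕ, (0 : ℝ))) by
    rwa [tsum_zero] at h
  refine tendsto_tsum_of_dominated_convergence
    (bound := fun i => (2 / (1 - c)) * ρ ^ i + 2 * ρ ^ i + (1 / (1 - c) + 1) * ρ ^ i)
    (((hgeo.mul_left _).add (hgeo.mul_left _)).add (hgeo.mul_left _)) ?_ ?_
  · intro i
    have h1 := tendsto_coverProb_sub_exp hc0 hc1 hs hF (m := fun n => k n + i) (p := i)
      (Eventually.of_forall fun n => by simp [hk])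
    have hki : ∀ᶠ n in atTop, i < k n :=
      (tendsto_floor_logb_atTop hc0 hc1).eventually_gt_atTop i
    have h2 := tendsto_coverProb_sub_exp hc0 hc1 hs hF (m := fun n => k n - 1 - i)
      (p := -((i : ℝ) + 1)) (by
        filter_upwards [hki] with n hn
        rw [Nat.sub_sub, Nat.cast_sub (by omega)]
        push_cast; ring)
    have h3 := (h1.add h2).neg
    rw [add_zero, neg_zero] at h3
    refine h3.congr' ?_
    filter_upwards [hki] with n hn
    simp only [hf, gTerm_succ, if_pos hn, hy]
    ring
  · filter_upwards [hq, eventually_mul_avoidProb_one_pow_mem hc0 hc1 hs,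
      eventually_ge_atTop 2] with n h1 h2 hn i
    set q := avoidProb n (s n) 1
    have hq0 : 0 < q := h1.1
    have hqi : q ^ i ≤ ρ ^ i := pow_le_pow_left₀ hq0.le h1.2 i
    have hai : (1 - c) ^ i ≤ ρ ^ i := pow_le_pow_left₀ ha.le (by linarith) i
    have hu0 : 0 ≤ 1 - F n (k n + i) := sub_nonneg.2 (hF1 _ _)
    have hu : 1 - F n (k n + i) ≤ 2 / (1 - c) * ρ ^ i := by
      refine (hU n _).trans ?_
      rw [pow_add, ← mul_assoc]
      exact mul_le_mul h2.2 hqi (by positivity) (by positivity)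
    have hv0 : 0 ≤ if i < k n then F n (k n - 1 - i) else 0 := by
      split_ifs
      exacts [hF0 _ _, le_rfl]
    have hv : (if i < k n then F n (k n - 1 - i) else 0) ≤ 2 * ρ ^ i := by
      split_ifs with hik
      · set j := k n - 1 - i with hj
        have hnpos : (0 : ℝ) < n := by
          have : 0 < n := by omega
          exact_mod_cast this
        have hl : 0 < n * q ^ j := by positivity
        have h3 : n * q ^ j * F n j ≤ 1 := by
          have := hV n j hn
          rw [sq, mul_assoc] at this
          exact le_of_mul_le_mul_left (by linarith) hl
        -- The mean at `j` is the mean at `k n`, at least `1/2`, divided by `q ^ (i + 1)`; with `h3`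
        -- this gives `F n j ≤ 2 * q ^ (i + 1)`.
        have h4 : (1 / 2 : ℝ) ≤ n * q ^ j * q ^ (i + 1) := by
          have : k n = j + (i + 1) := by omega
          have h5 := h2.1
          change (1 / 2 : ℝ) ≤ n * q ^ k n at h5
          rwa [this, pow_add, ← mul_assoc] at h5
        have h5 : q ^ (i + 1) ≤ ρ ^ i := by
          rw [pow_succ]
          exact (mul_le_of_le_one_right (by positivity) (h1.2.trans hρ1.le)).trans hqi
        have h6 : (1 / 2 : ℝ) * F n j ≤ n * q ^ j * q ^ (i + 1) * F n j :=
          mul_le_mul_of_nonneg_right h4 (hF0 _ _)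
        have h7 : (n * q ^ j * F n j) * q ^ (i + 1) ≤ 1 * q ^ (i + 1) :=
          mul_le_mul_of_nonneg_right h3 (by positivity)
        linarith
      · positivity
    have hg := abs_gTerm_succ_le hc0 hc1 (hy01 n) i
    have hg' : (1 / (1 - c) + 1) * (1 - c) ^ i ≤ (1 / (1 - c) + 1) * ρ ^ i :=
      mul_le_mul_of_nonneg_left hai (by positivity)
    rw [abs_le] at hg
    simp only [hf, Real.norm_eq_abs]
    rw [abs_le]
    constructor <;> linarith

end Asymptotics

theorem theorem2 (c : ℝ) (hc0 : 0 < c) (hc1 : c < 1)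
    -- the package size is `c n`, rounded to an integer (up or down)
    (s : ℕ → ℕ) (hs : ∀ n, |(s n : ℝ) - c * n| < 1)
    (Ω : ℕ → Type*) [∀ n, MeasurableSpace (Ω n)]
    (μ : ∀ n, Measure (Ω n)) [∀ n, IsProbabilityMeasure (μ n)]
    (A : ∀ n, ℕ → Ω n → Finset (Fin n))
    (hA : ∀ n, IsUniformPackageDraws (s n) (μ n) (A n)) :
    (∀ x ∈ Set.Ico (0 : ℝ) 1, Summable fun i : ℕ => gTerm c x (i + 1)) ∧
    (∀ᶠ n in atTop, expectedCollectionTime (μ n) (A n) ≠ ⊤) ∧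
    Tendsto (fun n : ℕ =>
      (expectedCollectionTime (μ n) (A n)).toReal
        - ((⌊Real.logb (1 / (1 - c)) n⌋ : ℝ) + g c (Int.fract (Real.logb (1 / (1 - c)) n))))
      atTop (𝓝 0) := by
  refine ⟨fun x hx => summable_gTerm_succ hc0 hc1 hx, ?_⟩
  obtain ⟨hsum, hlim⟩ := tendsto_tsum_one_sub_coverProb
    (F := fun n m => (μ n).real {ω | missed (A n) m ω = ∅}) hc0 hc1 hs
    (fun n m => (hA n).measureReal_missed_eq_empty m) (fun n m => measureReal_nonneg)
    (fun n m => measureReal_le_one) (fun n m => (hA n).one_sub_measureReal_missed_eq_empty_le m)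
    (fun n m hn => (hA n).sq_mul_measureReal_missed_eq_empty_le m
      (avoidProb_le_pow (size_le hc1 hs n) hn))
  have hE : ∀ᶠ n in atTop, expectedCollectionTime (μ n) (A n) =
      ENNReal.ofReal (∑' m, (1 - (μ n).real {ω | missed (A n) m ω = ∅})) := by
    filter_upwards [hsum] with n hn
    rw [(hA n).expectedCollectionTime_eq_tsum, ENNReal.ofReal_tsum_of_nonneg
      (fun m => sub_nonneg.2 measureReal_le_one) hn]
  constructor
  · filter_upwards [hE] with n hn
    rw [hn]
    exact ENNReal.ofReal_ne_top
  · refine hlim.congr' ?_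
    filter_upwards [hE] with n hn
    rw [hn, ENNReal.toReal_ofReal (tsum_nonneg fun m => sub_nonneg.2 measureReal_le_one)]
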